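/- **Setting.** Let $2<p<6$, $2<r<4$, $\alpha,\sigma\in\mathbb R$, $\beta\ge 0$ and $\mu>0$. Let $K_0(x)=\int_0^\infty e^{-x\cosh t}\,dt$ ($x>0$) be the Macdonald function of order zero. Let $\mathcal D$ be the set of pairs $U=(u,v)$ with $$u\in H^1(\mathbb R;\mathbb C),\qquad v=\phi+\frac{q}{2\pi}K_0(|\cdot|),\qquad \phi\in H^1(\mathbb R^2;\mathbb C),\quad q\in\mathbb C$$ (since $K_0(|\cdot|)\notin H^1(\mathbb R^2)$, $\phi$ and $q$ are determined by $v$). For $U\in\mathcal D$ the mass is $\|U\|^2=\int_{\mathbb R}|u|^2\,dx+\int_{\mathbb R^2}|v|^2\,dx$ and the energy is $$E(U)=\tfrac12\|u'\|_{L^2(\mathbb R)}^2+\tfrac{\alpha}{2}|u(0)|^2-\tfrac1p\|u\|_{L^p(\mathbb R)}^p+\tfrac12\|\phi\|_{H^1(\mathbb R^2)}^2-\tfrac12\|v\|_{L^2(\mathbb R^2)}^2+\tfrac{\sigma}{2}|q|^2-\tfrac1r\|v\|_{L^r(\mathbb R^2)}^r-\beta\,\mathrm{Re}\big(\overline q\,u(0)\big),$$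 where $u(0)$ is the value at $0$ of the continuous representative of $u$ and $\|\phi\|_{H^1}^2=\|\phi\|_{L^2}^2+\|\nabla\phi\|_{L^2}^2$. Put $\mathcal D^\mu=\{U\in\mathcal D:\|U\|^2=\mu\}$ and $\mathcal E(\mu)=\inf_{U\in\mathcal D^\mu}E(U)\in[-\infty,+\infty]$. A *Ground State at mass* $\mu$ is a $U\in\mathcal D^\mu$ with $E(U)\le E(W)$ for all $W\in\mathcal D^\mu$. A *minimizing sequence* at mass $\mu$ is a sequence $(U_n)\subset\mathcal D^\mu$ with $E(U_n)\to\mathcal E(\mu)$. A state $U=(u,\ \phi+\frac{q}{2\pi}K_0(|\cdot|))\in\mathcal D$ is a *weak limit* of a sequence $U_n=(u_n,\ \phi_n+\frac{q_n}{2\pi}K_0(|\cdot|))\in\mathcal D$ if, along a subsequence, $u_n\rightharpoonup u$ weakly in $H^1(\mathbb R)$, $\phi_n\rightharpoonup\phi$ weakly in $H^1(\mathbb R^2)$ and $q_n\to q$ in $\mathbb C$. **Proposition.** Let $(U_n)\subset\mathcal D^\mu$ be a minimizing sequence at mass $\mu$ and let $U\in\mathcal D$ be a weak limit of it. If $\|U\|^2=\mu$,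 then $U$ is a Ground State at mass $\mu$. -/

import Mathlib

open MeasureTheory Filter Topology
open scoped ComplexConjugate SchwartzMap LineDeriv

noncomputable section

namespace Hybrid

/-! ### The Sobolev space `H¹` -/

section Sobolev

variable {ι E : Type*} [Fintype ι] [NormedAddCommGroup E] [InnerProductSpace ℝ E]
  [FiniteDimensional ℝ E] [MeasurableSpace E] [BorelSpace E]

/-- The Sobolev space `H¹(E)` of complex-valued functions, `b` being an orthonormal basis of `E`:
the pairs `(f, g)` of a function `f ∈ L²` and a family `g` of `L²` functions such that `g i` is
the partial derivative of `f` in direction `b i` in the sense of (tempered) distributions, i.e.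
`∫ η (g i) = - ∫ (∂_{b i} η) f` for all Schwartz functions `η`. As `f` determines `g`, this is the
usual space of all `f ∈ L²` with weak gradient in `L²`. The inner product and the norm inherited
from the Hilbert sum of the `L²` spaces are those of `H¹`: `‖(f, g)‖² = ‖f‖² + ∑ i, ‖g i‖²`. -/
def H1 (b : OrthonormalBasis ι ℝ E) :
    Submodule ℂ (WithLp 2 (Lp ℂ 2 (volume : Measure E) ×
      PiLp 2 (fun _ : ι => Lp ℂ 2 (volume : Measure E)))) where
  carrier := {w | ∀ i, ∂_{b i} (Lp.toTemperedDistribution w.fst) =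
    Lp.toTemperedDistribution (w.snd i)}
  add_mem' := by
    intro w w' hw hw' i
    simp only [← Lp.toTemperedDistributionCLM_apply] at hw hw' ⊢
    simp only [WithLp.add_fst, WithLp.add_snd, PiLp.add_apply, map_add,
      LineDeriv.lineDerivOp_add]
    exact congrArg₂ (· + ·) (hw i) (hw' i)
  zero_mem' := by
    intro i
    simp only [← Lp.toTemperedDistributionCLM_apply]
    simp only [WithLp.zero_fst, WithLp.zero_snd, PiLp.zero_apply, map_zero]
    exact LineDeriv.lineDerivOp_zero (b i)
  smul_mem' := by
    intro c w hw i
    simp only [← Lp.toTemperedDistributionCLM_apply] at hw ⊢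
    simp only [WithLp.smul_fst, WithLp.smul_snd, PiLp.smul_apply, map_smul,
      LineDeriv.lineDerivOp_smul]
    exact congrArg (c • ·) (hw i)

/-- The function underlying an element of `H¹`. -/
def H1.toFn {b : OrthonormalBasis ι ℝ E} (f : H1 b) : E → ℂ := f.1.fst

/-- The `L²` norm of the weak gradient. -/
def H1.gradNorm {b : OrthonormalBasis ι ℝ E} (f : H1 b) : ℝ := ‖f.1.snd‖

end Sobolev

/-- Weak convergence of a sequence in a normed space: convergence in the weak topology. -/
def WeakTendsto {H : Type*} [NormedAddCommGroup H] [NormedSpace ℂ H] (x : ℕ → H) (y : H) : Prop :=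
  Tendsto (fun n => toWeakSpace ℂ H (x n)) atTop (𝓝 (toWeakSpace ℂ H y))

/-- The plane `Π = ℝ²` with its Euclidean norm. -/
abbrev Plane : Type := EuclideanSpace ℝ (Fin 2)

/-- `H¹(ℝ)`. -/
abbrev H1Line := H1 (OrthonormalBasis.singleton Unit ℝ)

/-- `H¹(ℝ²)`. -/
abbrev H1Plane := H1 (EuclideanSpace.basisFun (Fin 2) ℝ)

open scoped Classical in
/-- The point value `u(0)` of `u ∈ H¹(ℝ)`: the value at `0` of the continuous function that is
equal to `u` almost everywhere (it exists, because `H¹(ℝ)` embeds into the continuous functions,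
and is unique, so that the `else` branch never occurs). -/
def valueAtZero (u : H1Line) : ℂ :=
  if h : ∃ g : ℝ → ℂ, Continuous g ∧ H1.toFn u =ᵐ[volume] g then h.choose 0 else 0

/-- The Macdonald function `K₀(x) = ∫₀^∞ exp(-x cosh t) dt`, `x > 0`. -/
def besselK0 (x : ℝ) : ℝ := ∫ t in Set.Ioi (0 : ℝ), Real.exp (-x * Real.cosh t)

/-! ### States, energy, ground states -/

/-- An element `U = (u, v)` of the energy domain `𝒟`: `u ∈ H¹(ℝ)` and `v = φ + q K₀ / (2π)` with
`φ ∈ H¹(ℝ²)` and `q ∈ ℂ`. Since `K₀(|x|)` is not in `H¹(ℝ²)`, `φ` and `q` are determined by `v`,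
so that `U` is the same thing as the triple `(u, φ, q)`. -/
structure EnergyDomain where
  /-- the component on the line -/
  u : H1Line
  /-- the regular part of the component on the plane -/
  φ : H1Plane
  /-- the charge -/
  q : ℂ

namespace EnergyDomain

/-- The component `v = φ + q K₀ / (2π)` on the plane. -/
def v (U : EnergyDomain) (x : Plane) : ℂ :=
  H1.toFn U.φ x + U.q * (besselK0 ‖x‖ / (2 * Real.pi) : ℝ)

/-- The mass `∫_ℓ |u|² + ∫_Π |v|²`. -/
def mass (U : EnergyDomain) : ℝ := (∫ x, ‖H1.toFn U.u x‖ ^ 2) + ∫ x, ‖U.v x‖ ^ 2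

/-- The energy of the component on the line. -/
def energyLine (α p : ℝ) (U : EnergyDomain) : ℝ :=
  1 / 2 * H1.gradNorm U.u ^ 2 - 1 / p * (∫ x, ‖H1.toFn U.u x‖ ^ p)
    + α / 2 * ‖valueAtZero U.u‖ ^ 2

/-- The energy of the component on the plane; `‖U.φ‖` is the `H¹` norm. -/
def energyPlane (σ r : ℝ) (U : EnergyDomain) : ℝ :=
  1 / 2 * ‖U.φ‖ ^ 2 - 1 / 2 * (∫ x, ‖U.v x‖ ^ 2) + σ / 2 * ‖U.q‖ ^ 2
    - 1 / r * (∫ x, ‖U.v x‖ ^ r)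

/-- The energy `E(U) = E_α(u, ℓ) + E_σ(v, Π) - β Re (q̄ u(0))`. -/
def energy (α σ β p r : ℝ) (U : EnergyDomain) : ℝ :=
  energyLine α p U + energyPlane σ r U - β * (conj U.q * valueAtZero U.u).re

end EnergyDomain

/-- The set `𝒟^μ` of the states of mass `μ`. -/
def massDomain (μ : ℝ) : Set EnergyDomain := {U | U.mass = μ}

/-- The infimum `ℰ(μ)` of the energy over `𝒟^μ`, as an extended real number. -/
def infEnergy (α σ β p r μ : ℝ) : EReal :=
  ⨅ U ∈ massDomain μ, ((U.energy α σ β p r : ℝ) : EReal)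

/-- `U` is a ground state at mass `μ`. -/
def IsGroundState (α σ β p r μ : ℝ) (U : EnergyDomain) : Prop :=
  U ∈ massDomain μ ∧ ∀ W ∈ massDomain μ, U.energy α σ β p r ≤ W.energy α σ β p r

/-- `Us` is a minimizing sequence at mass `μ`. -/
def IsMinimizingSeq (α σ β p r μ : ℝ) (Us : ℕ → EnergyDomain) : Prop :=
  (∀ n, Us n ∈ massDomain μ) ∧
    Tendsto (fun n => (((Us n).energy α σ β p r : ℝ) : EReal)) atTop
      (𝓝 (infEnergy α σ β p r μ))

/-- `U` is a weak limit of the sequence `Us`: along a subsequence, `u_n` converges to `u` weakly in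
`H¹(ℝ)`, `φ_n` converges to `φ` weakly in `H¹(ℝ²)`, and `q_n` converges to `q`. -/
def IsWeakLimit (Us : ℕ → EnergyDomain) (U : EnergyDomain) : Prop :=
  ∃ k : ℕ → ℕ, StrictMono k ∧ WeakTendsto (fun n => (Us (k n)).u) U.u ∧
    WeakTendsto (fun n => (Us (k n)).φ) U.φ ∧ Tendsto (fun n => (Us (k n)).q) atTop (𝓝 U.q)

end Hybrid

end

open MeasureTheory Filter Topology
open scoped ComplexConjugate SchwartzMap LineDeriv

noncomputable section

namespace Hybrid

/-! No mass is lost, so weak `L²` convergence of the pair `(u_n, v_n)` is strong. As `q_n → q` and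
`K₀(|x|) ∈ L²`, also `φ_n → φ` in `L²`. Weakly convergent sequences are bounded in `H¹`, and
interpolation between `L²` and `H¹` then gives convergence of the `L^p` and `L^r` terms and of
`u_n(0)`. Only `‖u'‖²` and `‖φ‖²` may fail to converge. Both are weakly lower semicontinuous, so
`E(U)` is at most the limit of the energies, which is the infimum; no compact embedding is needed.

`tendsto_L2_of_mass` gives the strong convergence and `exists_tendsto_energy_le` the semicontinuity.
The interpolation inequalities rest on `|f|² ≤ 2 ∫ |f f'|` for Schwartz functions: it bounds the sup
norm on the line and, used in both coordinate directions, yields Ladyzhenskaya's inequality on the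
plane. Density of Schwartz functions (`denseRange_ofSchwartz`) carries both to `H¹`. -/

theorem denseRange_of_orthogonal_eq_zero {S H : Type*} [AddCommGroup S] [Module ℂ S]
    [NormedAddCommGroup H] [InnerProductSpace ℂ H] (M : Submodule ℂ H) [CompleteSpace M]
    (f : S →ₗ[ℂ] M) (h : ∀ w : M, (∀ s, inner ℂ (f s : H) (w : H) = 0) → w = 0) :
    DenseRange f := by
  have : (LinearMap.range f).topologicalClosure = ⊤ := by
    rw [Submodule.topologicalClosure_eq_top_iff, Submodule.eq_bot_iff]
    intro w hw
    exact h w fun s => (Submodule.mem_orthogonal _ _).1 hw _ ⟨s, rfl⟩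
  exact (Submodule.dense_iff_topologicalClosure_eq_top).2 this

/-! ### Density of Schwartz functions in `H¹` -/

section Density

variable {ι E : Type*} [Fintype ι] [NormedAddCommGroup E] [InnerProductSpace ℝ E]
  [FiniteDimensional ℝ E] [MeasurableSpace E] [BorelSpace E]

variable (ι E) in
/-- The Hilbert space of a function and `ι` partial derivatives that contains `H¹`. -/
abbrev H1Ambient : Type _ :=
  WithLp 2 (Lp ℂ 2 (volume : Measure E) × PiLp 2 (fun _ : ι => Lp ℂ 2 (volume : Measure E)))

theorem mem_H1 {b : OrthonormalBasis ι ℝ E} {w : H1Ambient ι E} :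
    w ∈ H1 b ↔ ∀ i, ∂_{b i} (Lp.toTemperedDistribution w.fst) =
      Lp.toTemperedDistribution (w.snd i) := Iff.rfl

theorem isClosed_H1 (b : OrthonormalBasis ι ℝ E) : IsClosed (H1 b : Set (H1Ambient ι E)) := by
  have : (H1 b : Set (H1Ambient ι E)) = ⋂ i, {w |
        LineDeriv.lineDerivOpCLM ℂ 𝓢'(E, ℂ) (b i)
          (Lp.toTemperedDistributionCLM ℂ volume 2 w.fst) =
        Lp.toTemperedDistributionCLM ℂ volume 2 (w.snd i)} := by
    ext w
    simp [mem_H1]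
  rw [this]
  refine isClosed_iInter fun i => isClosed_eq ?_ ?_
  · refine (ContinuousLinearMap.continuous _).comp ((ContinuousLinearMap.continuous _).comp ?_)
    exact (WithLp.fstL 2 ℂ _ _).continuous
  · refine (ContinuousLinearMap.continuous _).comp ?_
    exact (PiLp.continuous_apply 2 _ i).comp (WithLp.sndL 2 ℂ _ _).continuous

instance completeSpace_H1 (b : OrthonormalBasis ι ℝ E) : CompleteSpace (H1 b) :=
  (isClosed_H1 b).completeSpace_coe

/-- A Schwartz function together with its gradient. -/
def schwartzGraph (b : OrthonormalBasis ι ℝ E) : 𝓢(E, ℂ) →ₗ[ℂ] H1Ambient ι E where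
  toFun f := WithLp.toLp 2 (f.toLp 2, WithLp.toLp 2 fun i => (∂_{b i} f : 𝓢(E, ℂ)).toLp 2)
  map_add' f g := by
    simp only [LineDeriv.lineDerivOp_add, ← SchwartzMap.toLpCLM_apply (𝕜 := ℂ), map_add]
    rfl
  map_smul' c f := by
    simp only [LineDeriv.lineDerivOp_smul, ← SchwartzMap.toLpCLM_apply (𝕜 := ℂ), map_smul]
    rfl

theorem schwartzGraph_fst (b : OrthonormalBasis ι ℝ E) (f : 𝓢(E, ℂ)) :
    (schwartzGraph b f).fst = f.toLp 2 := rfl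

theorem schwartzGraph_snd (b : OrthonormalBasis ι ℝ E) (f : 𝓢(E, ℂ)) (i : ι) :
    (schwartzGraph b f).snd i = (∂_{b i} f : 𝓢(E, ℂ)).toLp 2 := rfl

theorem schwartzGraph_mem (b : OrthonormalBasis ι ℝ E) (f : 𝓢(E, ℂ)) :
    schwartzGraph b f ∈ H1 b := by
  rw [mem_H1]
  intro i
  rw [schwartzGraph_fst, schwartzGraph_snd, Lp.toTemperedDistribution_toLp_eq,
    Lp.toTemperedDistribution_toLp_eq]
  exact TemperedDistribution.lineDerivOp_toTemperedDistributionCLM_eq f (b i)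

/-- A Schwartz function as an element of `H¹`. -/
def H1.ofSchwartz (b : OrthonormalBasis ι ℝ E) : 𝓢(E, ℂ) →ₗ[ℂ] H1 b :=
  (schwartzGraph b).codRestrict (H1 b) (schwartzGraph_mem b)

open Laplacian in
-- On the Fourier side `1 - Δ` multiplies by `1 + ‖2πξ‖²`, whose inverse is smooth of temperate
-- growth and hence preserves Schwartz functions.
theorem exists_schwartz_sub_laplacian_eq (ψ : 𝓢(E, ℂ)) : ∃ χ : 𝓢(E, ℂ), χ - Δ χ = ψ := by
  have h1 : (fun ξ : E => ((1 + ‖(2 * Real.pi) • ξ‖ ^ 2) ^ (-1 : ℝ) : ℝ)).HasTemperateGrowth := by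
    exact (Function.hasTemperateGrowth_one_add_norm_sq_rpow E (-1)).comp
      (g := fun x : E => (1 + ‖x‖ ^ 2) ^ (-1 : ℝ)) (f := fun ξ : E => (2 * Real.pi) • ξ)
      (by fun_prop)
  refine ⟨SchwartzMap.fourierMultiplierCLM ℂ
    (fun ξ : E => ((1 + ‖(2 * Real.pi) • ξ‖ ^ 2) ^ (-1 : ℝ) : ℝ)) ψ, ?_⟩
  rw [SchwartzMap.laplacian_eq_fourierMultiplierCLM,
    SchwartzMap.fourierMultiplierCLM_fourierMultiplierCLM_apply (by fun_prop) h1]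
  have h2 : ((fun ξ : E => ‖ξ‖ ^ 2) *
      fun ξ : E => ((1 + ‖(2 * Real.pi) • ξ‖ ^ 2) ^ (-1 : ℝ) : ℝ)).HasTemperateGrowth := by
    exact Function.HasTemperateGrowth.mul (by fun_prop) h1
  have h3 := SchwartzMap.smulLeftCLM_add (F := ℂ) h1
    (g₂ := (2 * Real.pi) ^ 2 • ((fun ξ : E => ‖ξ‖ ^ 2) *
      fun ξ : E => ((1 + ‖(2 * Real.pi) • ξ‖ ^ 2) ^ (-1 : ℝ) : ℝ))) (by fun_prop)
  rw [neg_smul, sub_neg_eq_add, ← smul_apply,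
    ← SchwartzMap.fourierMultiplierCLM_smul h2, SchwartzMap.fourierMultiplierCLM_apply,
    SchwartzMap.fourierMultiplierCLM_apply, ← FourierTransform.fourierInv_add,
    ← add_apply, ← h3]
  have h4 : ((fun ξ : E => ((1 + ‖(2 * Real.pi) • ξ‖ ^ 2) ^ (-1 : ℝ) : ℝ)) +
      (2 * Real.pi) ^ 2 • ((fun ξ : E => ‖ξ‖ ^ 2) *
        fun ξ : E => ((1 + ‖(2 * Real.pi) • ξ‖ ^ 2) ^ (-1 : ℝ) : ℝ))) = fun _ => 1 := by
    funext ξ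
    have : 0 < 1 + ‖(2 * Real.pi) • ξ‖ ^ 2 := by positivity
    simp only [Pi.add_apply, Pi.smul_apply, Pi.mul_apply, smul_eq_mul, Real.rpow_neg_one]
    field_simp
    rw [norm_smul, mul_pow, Real.norm_eq_abs, sq_abs]
    ring
  rw [h4]
  simp

/-- The inner product is conjugate-linear in its first slot while the distributional pairing is
bilinear; conjugating the test function passes between them. -/
theorem inner_toLp_conj (f : 𝓢(E, ℂ)) (w : Lp ℂ 2 (volume : Measure E)) :
    inner ℂ ((SchwartzMap.postcompCLM (𝕜 := ℝ) (Complex.conjCLE : ℂ →L[ℝ] ℂ) f).toLp 2) w =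
      Lp.toTemperedDistribution w f := by
  rw [Lp.toTemperedDistribution_apply, L2.inner_def]
  refine integral_congr_ae ?_
  filter_upwards [SchwartzMap.coeFn_toLp
    (SchwartzMap.postcompCLM (𝕜 := ℝ) (Complex.conjCLE : ℂ →L[ℝ] ℂ) f) 2 volume] with x hx
  rw [hx]
  simp [mul_comm]

theorem lineDerivOp_postcomp_conj (f : 𝓢(E, ℂ)) (m : E) :
    ∂_{m} (SchwartzMap.postcompCLM (𝕜 := ℝ) (Complex.conjCLE : ℂ →L[ℝ] ℂ) f) =
      SchwartzMap.postcompCLM (𝕜 := ℝ) (Complex.conjCLE : ℂ →L[ℝ] ℂ) (∂_{m} f) := by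
  ext x
  rw [SchwartzMap.postcompCLM_apply, SchwartzMap.lineDerivOp_apply_eq_fderiv,
    SchwartzMap.lineDerivOp_apply_eq_fderiv]
  have : (SchwartzMap.postcompCLM (𝕜 := ℝ) (Complex.conjCLE : ℂ →L[ℝ] ℂ) f : E → ℂ) =
    (Complex.conjCLE : ℂ →L[ℝ] ℂ) ∘ f := rfl
  rw [this, fderiv_comp x (by fun_prop) f.differentiableAt, ContinuousLinearMap.fderiv]
  rfl

open Laplacian in
-- Moving the derivatives back onto the test function turns orthogonality into `w.fst (χ - Δ χ) =
-- 0`. Since `1 - Δ` is onto the Schwartz space, `w.fst` vanishes, and with it the weak gradient.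
theorem eq_zero_of_orthogonal_schwartzGraph (b : OrthonormalBasis ι ℝ E) (w : H1 b)
    (h : ∀ f, inner ℂ (schwartzGraph b f) w.1 = 0) : w = 0 := by
  have key : ∀ χ : 𝓢(E, ℂ), Lp.toTemperedDistribution w.1.fst (χ - Δ χ) = 0 := by
    intro χ
    have h1 := h (SchwartzMap.postcompCLM (𝕜 := ℝ) (Complex.conjCLE : ℂ →L[ℝ] ℂ) χ)
    rw [WithLp.prod_inner_apply, PiLp.inner_apply] at h1
    change inner ℂ (schwartzGraph b _).fst w.1.fst +
      ∑ i, inner ℂ ((schwartzGraph b _).snd i) (w.1.snd i) = 0 at h1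
    simp_rw [schwartzGraph_fst, schwartzGraph_snd, lineDerivOp_postcomp_conj,
      inner_toLp_conj] at h1
    have h2 : ∀ i, Lp.toTemperedDistribution (w.1.snd i) (∂_{b i} χ) =
        - Lp.toTemperedDistribution w.1.fst (∂_{b i} (∂_{b i} χ)) := by
      intro i
      rw [← mem_H1.1 w.2 i, TemperedDistribution.lineDerivOp_apply_apply, map_neg]
    simp_rw [h2] at h1
    rw [map_sub, SchwartzMap.laplacian_eq_sum b, map_sum, sub_eq_add_neg, ← Finset.sum_neg_distrib]
    exact h1
  have h0 : Lp.toTemperedDistribution w.1.fst = 0 := by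
    ext ψ
    obtain ⟨χ, rfl⟩ := exists_schwartz_sub_laplacian_eq ψ
    exact key χ
  have inj : ∀ g : Lp ℂ 2 (volume : Measure E), Lp.toTemperedDistribution g = 0 → g = 0 := by
    intro g hg
    have := Lp.ker_toTemperedDistributionCLM_eq_bot (F := ℂ) (μ := (volume : Measure E)) (p := 2)
    exact (LinearMap.ker_eq_bot'.1 this) g hg
  have hs : ∀ i, w.1.snd i = 0 := by
    intro i
    apply inj
    rw [← mem_H1.1 w.2 i, h0, LineDeriv.lineDerivOp_zero]
  apply Subtype.ext
  apply (WithLp.ofLp_injective 2)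
  exact Prod.ext (inj _ h0) (PiLp.ext hs)

theorem denseRange_ofSchwartz (b : OrthonormalBasis ι ℝ E) :
    DenseRange (H1.ofSchwartz b) :=
  denseRange_of_orthogonal_eq_zero (H1 b) _ (eq_zero_of_orthogonal_schwartzGraph b)

end Density

/-! ### From one-dimensional integration to estimates on `H¹` -/

/-- Integrate `(f²)' = 2 f f'` from `-∞`. The complex square is used because, unlike `|f|`, it is
differentiable everywhere. -/
theorem enorm_sq_le_lintegral_of_hasDerivAt {f f' : ℝ → ℂ} (hf : ∀ x, HasDerivAt f (f' x) x)
    (hf' : Continuous f') (h0 : Tendsto f atBot (𝓝 0)) (x : ℝ) :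
    ‖f x‖ₑ ^ 2 ≤ 2 * ∫⁻ y, ‖f y‖ₑ * ‖f' y‖ₑ := by
  by_cases hfin : ∫⁻ y, ‖f y‖ₑ * ‖f' y‖ₑ = ⊤
  · simp [hfin]
  have hc : Continuous f := continuous_iff_continuousAt.2 fun x => (hf x).continuousAt
  have hint : Integrable fun y => f y * f' y := by
    refine ⟨(hc.mul hf').aestronglyMeasurable, ?_⟩
    simpa [HasFiniteIntegral, enorm_mul] using lt_top_iff_ne_top.2 hfin
  have key := integral_Iic_of_hasDerivAt_of_tendsto' (a := x) (f := fun y => f y ^ 2)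
    (f' := fun y => 2 * (f y * f' y)) (m := 0)
    (fun y _ => ((hf y).fun_pow 2).congr_deriv (by push_cast; ring)) (hint.const_mul 2).integrableOn
    (by simpa using h0.pow 2)
  rw [sub_zero] at key
  rw [← enorm_pow, ← key]
  refine (enorm_integral_le_lintegral_enorm _).trans ?_
  refine (setLIntegral_le_lintegral _ _).trans ?_
  simp_rw [enorm_mul]
  rw [lintegral_const_mul _ (by fun_prop)]
  gcongr
  simp [enorm_eq_nnnorm]

section General

variable {ι E : Type*} [Fintype ι] [NormedAddCommGroup E] [InnerProductSpace ℝ E]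
  [FiniteDimensional ℝ E] [MeasurableSpace E] [BorelSpace E]

theorem H1.enorm_fst_le {b : OrthonormalBasis ι ℝ E} (w : H1 b) : ‖w.1.fst‖ₑ ≤ ‖w‖ₑ :=
  WithLp.enorm_fst_le _ w.1

theorem H1.norm_fst_le {b : OrthonormalBasis ι ℝ E} (w : H1 b) : ‖w.1.fst‖ ≤ ‖w‖ :=
  WithLp.norm_fst_le _ w.1

theorem H1.ofSchwartz_fst (b : OrthonormalBasis ι ℝ E) (f : 𝓢(E, ℂ)) :
    (H1.ofSchwartz b f).1.fst = f.toLp 2 := rfl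

theorem H1.ofSchwartz_snd (b : OrthonormalBasis ι ℝ E) (f : 𝓢(E, ℂ)) (i : ι) :
    (H1.ofSchwartz b f).1.snd i = (∂_{b i} f : 𝓢(E, ℂ)).toLp 2 := rfl

theorem H1.enorm_snd_le {b : OrthonormalBasis ι ℝ E} (w : H1 b) (i : ι) :
    ‖w.1.snd i‖ₑ ≤ ‖w‖ₑ :=
  (PiLp.enorm_apply_le w.1.snd i).trans (WithLp.enorm_snd_le _ w.1)

theorem lintegral_enorm_mul_enorm_le {f g : E → ℂ} (hf : AEStronglyMeasurable f volume)
    (hg : AEStronglyMeasurable g volume) :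
    ∫⁻ x, ‖f x‖ₑ * ‖g x‖ₑ ≤ eLpNorm f 2 volume * eLpNorm g 2 volume := by
  have := eLpNorm_smul_le_mul_eLpNorm (p := 2) (q := 2) (r := 1) hg hf
  simpa [eLpNorm_one_eq_lintegral_enorm, enorm_mul] using this

/-- Cauchy–Schwarz. The `L²` norm is kept as a separate factor so that, on bounded sets of `H¹`,
smallness in `L²` makes the bound small. -/
theorem lintegral_schwartz_mul_lineDeriv_le (b : OrthonormalBasis ι ℝ E) (f : 𝓢(E, ℂ)) (i : ι) :
    ∫⁻ x, ‖f x‖ₑ * ‖(∂_{b i} f : 𝓢(E, ℂ)) x‖ₑ ≤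
      ‖(H1.ofSchwartz b f).1.fst‖ₑ * ‖H1.ofSchwartz b f‖ₑ := by
  refine (lintegral_enorm_mul_enorm_le f.continuous.aestronglyMeasurable
    (SchwartzMap.continuous _).aestronglyMeasurable).trans ?_
  grw [← H1.enorm_snd_le _ i, H1.ofSchwartz_fst, H1.ofSchwartz_snd, Lp.enorm_def, Lp.enorm_def,
    eLpNorm_congr_ae (f.coeFn_toLp 2 volume),
    eLpNorm_congr_ae ((∂_{b i} f : 𝓢(E, ℂ)).coeFn_toLp 2 volume)]

theorem exists_schwartz_tendsto {b : OrthonormalBasis ι ℝ E} (h : H1 b) :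
    ∃ f : ℕ → 𝓢(E, ℂ), Tendsto (fun n => H1.ofSchwartz b (f n)) atTop (𝓝 h) ∧
      ∀ᵐ x, Tendsto (fun n => f n x) atTop (𝓝 (H1.toFn h x)) := by
  obtain ⟨v, hv, hlim⟩ := mem_closure_iff_seq_limit.1 (denseRange_ofSchwartz b h)
  choose f hf using hv
  obtain rfl : (fun n => H1.ofSchwartz b (f n)) = v := funext hf
  have hfst : Tendsto (fun n => (f n).toLp 2 volume) atTop (𝓝 h.1.fst) :=
    ((WithLp.fstL 2 ℂ _ _).continuous.comp continuous_subtype_val).continuousAt.tendsto.comp hlim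
  obtain ⟨ns, hns, hae⟩ := (tendstoInMeasure_of_tendsto_Lp hfst).exists_seq_tendsto_ae
  refine ⟨fun n => f (ns n), hlim.comp hns.tendsto_atTop, ?_⟩
  have : ∀ᵐ x, ∀ n, ((f n).toLp 2 volume) x = f n x :=
    ae_all_iff.2 fun n => (f n).coeFn_toLp 2 volume
  filter_upwards [hae, this] with x hx hx'
  simp only [hx'] at hx
  exact hx

end General

/-! ### Continuous representatives and point values on the line -/

section Line

theorem hasDerivAt_schwartz_line (f : 𝓢(ℝ, ℂ)) (x : ℝ) :
    HasDerivAt f ((∂_{OrthonormalBasis.singleton Unit ℝ ()} f : 𝓢(ℝ, ℂ)) x) x := by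
  rw [SchwartzMap.lineDerivOp_apply_eq_fderiv]
  simpa using f.differentiableAt.hasDerivAt

theorem enorm_schwartz_sq_le (f : 𝓢(ℝ, ℂ)) (x : ℝ) :
    ‖f x‖ₑ ^ 2 ≤ 2 * (‖(H1.ofSchwartz (OrthonormalBasis.singleton Unit ℝ) f).1.fst‖ₑ *
      ‖H1.ofSchwartz (OrthonormalBasis.singleton Unit ℝ) f‖ₑ) := by
  refine (enorm_sq_le_lintegral_of_hasDerivAt (hasDerivAt_schwartz_line f)
    (SchwartzMap.continuous _) ?_ x).trans ?_
  · exact f.tendsto_cocompact.mono_left atBot_le_cocompact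
  · gcongr
    exact lintegral_schwartz_mul_lineDeriv_le _ f ()

theorem norm_schwartz_sq_le (f : 𝓢(ℝ, ℂ)) (x : ℝ) :
    ‖f x‖ ^ 2 ≤ 2 * (‖(H1.ofSchwartz (OrthonormalBasis.singleton Unit ℝ) f).1.fst‖ *
      ‖H1.ofSchwartz (OrthonormalBasis.singleton Unit ℝ) f‖) := by
  have h := ENNReal.toReal_mono (by finiteness) (enorm_schwartz_sq_le f x)
  simpa [ENNReal.toReal_mul, ENNReal.toReal_pow] using h

/-- The embedding of `H¹(ℝ)` into the continuous functions. -/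
theorem H1Line.exists_continuous_rep (u : H1Line) :
    ∃ g : ℝ → ℂ, Continuous g ∧ H1.toFn u =ᵐ[volume] g ∧
      ∀ x, ‖g x‖ ^ 2 ≤ 2 * (‖u.1.fst‖ * ‖u‖) := by
  obtain ⟨f, hf, hae⟩ := exists_schwartz_tendsto u
  -- The sup bound applied to differences makes an `H¹`-Cauchy sequence uniformly Cauchy; `ε / 2`
  -- absorbs the constant `√2 < 2`.
  have hcau : CauchySeq fun n => (f n).toBoundedContinuousFunction := by
    rw [Metric.cauchySeq_iff]
    intro ε hε
    obtain ⟨N, hN⟩ := Metric.cauchySeq_iff.1 hf.cauchySeq (ε / 2) (by positivity)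
    refine ⟨N, fun m hm n hn => ?_⟩
    have h1 := hN m hm n hn
    rw [dist_eq_norm, ← map_sub] at h1
    refine lt_of_le_of_lt ((BoundedContinuousFunction.dist_le (C := Real.sqrt 2 * (ε / 2))
      (by positivity)).2 fun x => ?_) ?_
    · have h2 := norm_schwartz_sq_le (f m - f n) x
      have h3 : ‖(H1.ofSchwartz (OrthonormalBasis.singleton Unit ℝ) (f m - f n)).1.fst‖ ≤
        ‖H1.ofSchwartz (OrthonormalBasis.singleton Unit ℝ) (f m - f n)‖ :=
        H1.norm_fst_le _
      rw [dist_eq_norm]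
      refine abs_le_of_sq_le_sq' ?_ (by positivity) |>.2
      rw [mul_pow, Real.sq_sqrt (by norm_num)]
      refine h2.trans ?_
      rw [sq]
      gcongr
      exact h3.trans h1.le
    · have : Real.sqrt 2 < 2 := by
        rw [Real.sqrt_lt' (by norm_num)]; norm_num
      nlinarith
  obtain ⟨g, hg⟩ := cauchySeq_tendsto_of_complete hcau
  have hpt : ∀ x, Tendsto (fun n => f n x) atTop (𝓝 (g x)) := fun x =>
    (BoundedContinuousFunction.tendsto_iff_tendstoUniformly.1 hg).tendsto_at x
  refine ⟨g, g.continuous, ?_, fun x => ?_⟩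
  · filter_upwards [hae] with x hx
    exact tendsto_nhds_unique hx (hpt x)
  · refine le_of_tendsto_of_tendsto' ((hpt x).norm.pow 2) ?_ fun n => norm_schwartz_sq_le (f n) x
    refine Tendsto.const_mul _ (Tendsto.mul ?_ hf.norm)
    exact (((WithLp.fstL 2 ℂ _ _).continuous.comp
      continuous_subtype_val).continuousAt.tendsto.comp hf).norm

/-- Continuous functions that agree almost everywhere agree everywhere, so the choice of
representative is immaterial. -/
theorem valueAtZero_eq {u : H1Line} {g : ℝ → ℂ} (hg : Continuous g)
    (h : H1.toFn u =ᵐ[volume] g) : valueAtZero u = g 0 := by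
  have hex : ∃ g : ℝ → ℂ, Continuous g ∧ H1.toFn u =ᵐ[volume] g := ⟨g, hg, h⟩
  rw [valueAtZero, dif_pos hex]
  have := (hex.choose_spec.2.symm.trans h)
  rw [hex.choose_spec.1.ae_eq_iff_eq volume hg] at this
  exact congrFun this 0

theorem H1.toFn_sub_ae {ι E : Type*} [Fintype ι] [NormedAddCommGroup E] [InnerProductSpace ℝ E]
    [FiniteDimensional ℝ E] [MeasurableSpace E] [BorelSpace E] {b : OrthonormalBasis ι ℝ E}
    (u v : H1 b) : H1.toFn (u - v) =ᵐ[volume] fun x => H1.toFn u x - H1.toFn v x :=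
  Lp.coeFn_sub u.1.fst v.1.fst

theorem valueAtZero_sub (u v : H1Line) : valueAtZero (u - v) = valueAtZero u - valueAtZero v := by
  obtain ⟨g, hg, hug, -⟩ := H1Line.exists_continuous_rep u
  obtain ⟨k, hk, hvk, -⟩ := H1Line.exists_continuous_rep v
  rw [valueAtZero_eq hg hug, valueAtZero_eq hk hvk, valueAtZero_eq (hg.sub hk)]
  · rfl
  · filter_upwards [H1.toFn_sub_ae u v, hug, hvk] with x h1 h2 h3
    simp [h1, h2, h3]

theorem norm_valueAtZero_sq_le (u : H1Line) : ‖valueAtZero u‖ ^ 2 ≤ 2 * (‖u.1.fst‖ * ‖u‖) := by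
  obtain ⟨g, hg, hug, h⟩ := H1Line.exists_continuous_rep u
  rw [valueAtZero_eq hg hug]
  exact h 0

end Line

/-! ### Ladyzhenskaya's inequality on the plane -/

section Plane

/-- One factor of `G²` is bounded by a function of `t` alone, the other by a function of `s` alone,
so the double integral factors by Tonelli. -/
theorem lintegral_sq_le_of_le_lintegral {G F₀ F₁ : ℝ × ℝ → ENNReal} (hF₀ : Measurable F₀)
    (hF₁ : Measurable F₁) (h₀ : ∀ s t, G (s, t) ≤ ∫⁻ s', F₀ (s', t))
    (h₁ : ∀ s t, G (s, t) ≤ ∫⁻ t', F₁ (s, t')) :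
    ∫⁻ z, G z ^ 2 ≤ (∫⁻ z, F₀ z) * ∫⁻ z, F₁ z := by
  have m₀ : Measurable fun t => ∫⁻ s', F₀ (s', t) := hF₀.lintegral_prod_left'
  have m₁ : Measurable fun s => ∫⁻ t', F₁ (s, t') := hF₁.lintegral_prod_right'
  calc ∫⁻ z, G z ^ 2 ≤ ∫⁻ z : ℝ × ℝ, (∫⁻ t', F₁ (z.1, t')) * ∫⁻ s', F₀ (s', z.2) := by
        refine lintegral_mono fun z => ?_
        rw [sq]
        exact mul_le_mul' (h₁ z.1 z.2) (h₀ z.1 z.2)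
    _ = (∫⁻ s, ∫⁻ t', F₁ (s, t')) * ∫⁻ t, ∫⁻ s', F₀ (s', t) := by
        rw [Measure.volume_eq_prod, lintegral_prod_mul m₁.aemeasurable m₀.aemeasurable]
    _ = _ := by
        rw [Measure.volume_eq_prod, lintegral_prod _ hF₁.aemeasurable,
          lintegral_prod_symm _ hF₀.aemeasurable, mul_comm]

/-- Cartesian coordinates on the plane. -/
def planeEquiv : Plane ≃ᵐ ℝ × ℝ :=
  (MeasurableEquiv.toLp 2 (Fin 2 → ℝ)).symm.trans MeasurableEquiv.finTwoArrow

theorem measurePreserving_planeEquiv : MeasurePreserving planeEquiv :=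
  (EuclideanSpace.volume_preserving_symm_measurableEquiv_toLp (Fin 2)).trans
    (volume_preserving_finTwoArrow ℝ)

theorem planeEquiv_symm_apply (s t : ℝ) : planeEquiv.symm (s, t) = !₂[s, t] := rfl

theorem planeEquiv_symm_eq (s t : ℝ) :
    planeEquiv.symm (s, t) = s • EuclideanSpace.basisFun (Fin 2) ℝ 0 +
      t • EuclideanSpace.basisFun (Fin 2) ℝ 1 := by
  rw [planeEquiv_symm_apply]
  ext i
  fin_cases i <;> simp

theorem enorm_schwartz_sq_le_lintegral_lineDeriv {E : Type*} [NormedAddCommGroup E]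
    [InnerProductSpace ℝ E] [FiniteDimensional ℝ E] (f : 𝓢(E, ℂ)) {e : E} (he : ‖e‖ = 1) (c : E)
    (s : ℝ) : ‖f (s • e + c)‖ₑ ^ 2 ≤
      2 * ∫⁻ y : ℝ, ‖f (y • e + c)‖ₑ * ‖(∂_{e} f : 𝓢(E, ℂ)) (y • e + c)‖ₑ := by
  refine enorm_sq_le_lintegral_of_hasDerivAt (f := fun y : ℝ => f (y • e + c))
    (f' := fun y : ℝ => (∂_{e} f : 𝓢(E, ℂ)) (y • e + c)) (fun y => ?_) ?_ ?_ s
  · have h1 : HasDerivAt (fun y : ℝ => y • e + c) e y := by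
      simpa using ((hasDerivAt_id y).smul_const e).add_const c
    rw [SchwartzMap.lineDerivOp_apply_eq_fderiv]
    exact (f.differentiableAt.hasFDerivAt (x := y • e + c)).comp_hasDerivAt y h1
  · exact (SchwartzMap.continuous _).comp (by fun_prop)
  · refine f.tendsto_cocompact.comp ?_
    rw [← Metric.cobounded_eq_cocompact, ← tendsto_norm_atTop_iff_cobounded]
    -- As `e` is a unit vector, the points `y • e + c` leave every bounded set.
    refine tendsto_atTop_mono (f := fun y : ℝ => |y| - ‖c‖) (fun y => ?_) ?_
    · have := norm_sub_le (y • e + c) c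
      rw [add_sub_cancel_right, norm_smul, he, mul_one, Real.norm_eq_abs] at this
      linarith
    · exact tendsto_atTop_add_const_right _ _ tendsto_abs_atBot_atTop

/-- Ladyzhenskaya's inequality for Schwartz functions on the plane. -/
theorem lintegral_schwartz_pow_four_le (f : 𝓢(Plane, ℂ)) :
    ∫⁻ x, ‖f x‖ₑ ^ 4 ≤ 4 * (‖(H1.ofSchwartz (EuclideanSpace.basisFun (Fin 2) ℝ) f).1.fst‖ₑ *
      ‖H1.ofSchwartz (EuclideanSpace.basisFun (Fin 2) ℝ) f‖ₑ) ^ 2 := by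
  set b := EuclideanSpace.basisFun (Fin 2) ℝ with hb
  have mp := measurePreserving_planeEquiv.symm
  have tr : ∀ F : Plane → ENNReal, ∫⁻ z, F (planeEquiv.symm z) = ∫⁻ x, F x := fun F =>
    mp.lintegral_comp_emb planeEquiv.symm.measurableEmbedding F
  have mF : ∀ i, Measurable fun x => 2 * (‖f x‖ₑ * ‖(∂_{b i} f : 𝓢(Plane, ℂ)) x‖ₑ) := fun i =>
    ((f.continuous.measurable.enorm).mul
      (SchwartzMap.continuous _).measurable.enorm).const_mul _
  -- Here `G = |f|²` and `F_i = 2 |f| |∂_i f|`, each bound coming from a line parallel to an axis;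
  -- the two factors `2` give the final `4`.
  have key := lintegral_sq_le_of_le_lintegral
    (G := fun z => ‖f (planeEquiv.symm z)‖ₑ ^ 2)
    ((mF 0).comp planeEquiv.symm.measurable) ((mF 1).comp planeEquiv.symm.measurable)
    (fun s t => by
      simp only [Function.comp_apply, planeEquiv_symm_eq]
      refine (enorm_schwartz_sq_le_lintegral_lineDeriv f (b.norm_eq_one 0) _ s).trans ?_
      exact lintegral_const_mul_le _ _)
    (fun s t => by
      simp only [Function.comp_apply, planeEquiv_symm_eq]
      simp only [add_comm (s • _)]
      refine (enorm_schwartz_sq_le_lintegral_lineDeriv f (b.norm_eq_one 1) _ t).trans ?_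
      exact lintegral_const_mul_le _ _)
  simp only [Function.comp_def] at key
  rw [tr (fun x => (‖f x‖ₑ ^ 2) ^ 2), tr (fun x => 2 * (‖f x‖ₑ * ‖(∂_{b 0} f : 𝓢(Plane, ℂ)) x‖ₑ)),
    tr (fun x => 2 * (‖f x‖ₑ * ‖(∂_{b 1} f : 𝓢(Plane, ℂ)) x‖ₑ)),
    lintegral_const_mul' _ _ (by norm_num), lintegral_const_mul' _ _ (by norm_num)] at key
  simp only [← pow_mul] at key
  refine key.trans ?_
  grw [lintegral_schwartz_mul_lineDeriv_le b f 0, lintegral_schwartz_mul_lineDeriv_le b f 1]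
  apply le_of_eq
  ring

/-- Ladyzhenskaya's inequality. -/
theorem H1Plane.lintegral_pow_four_le (φ : H1Plane) :
    ∫⁻ x, ‖H1.toFn φ x‖ₑ ^ 4 ≤ 4 * (‖φ.1.fst‖ₑ * ‖φ‖ₑ) ^ 2 := by
  obtain ⟨f, hf, hae⟩ := exists_schwartz_tendsto φ
  -- Fatou's lemma along the almost everywhere convergent approximation: convergence in `L⁴` is not
  -- needed.
  calc ∫⁻ x, ‖H1.toFn φ x‖ₑ ^ 4 = ∫⁻ x, liminf (fun n => ‖f n x‖ₑ ^ 4) atTop := by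
        refine lintegral_congr_ae ?_
        filter_upwards [hae] with x hx
        exact (ENNReal.Tendsto.pow hx.enorm).liminf_eq.symm
    _ ≤ liminf (fun n => ∫⁻ x, ‖f n x‖ₑ ^ 4) atTop :=
        lintegral_liminf_le fun n => ((f n).continuous.measurable.enorm.pow_const 4)
    _ ≤ liminf (fun n => 4 * (‖(H1.ofSchwartz (EuclideanSpace.basisFun (Fin 2) ℝ) (f n)).1.fst‖ₑ *
      ‖H1.ofSchwartz (EuclideanSpace.basisFun (Fin 2) ℝ) (f n)‖ₑ) ^ 2) atTop :=
        liminf_le_liminf (Eventually.of_forall fun n => lintegral_schwartz_pow_four_le (f n))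
    _ = _ := by
        refine Tendsto.liminf_eq ?_
        refine ENNReal.Tendsto.const_mul ?_ (Or.inr (by norm_num))
        refine ENNReal.Tendsto.pow ?_
        refine ENNReal.Tendsto.mul ?_ (Or.inr (by finiteness)) hf.enorm (Or.inr (by finiteness))
        exact (((WithLp.fstL 2 ℂ _ _).continuous.comp
          continuous_subtype_val).continuousAt.tendsto.comp hf).enorm

end Plane

/-! ### Interpolation and convergence in `Lˢ` -/

section LpNorms

variable {α : Type*} [MeasurableSpace α] {ν : Measure α}

/-- Hölder with weights `(4 - r) / 2` and `(r - 2) / 2`, which sum to `1` and satisfy `2 (4 - r) / 2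
+ 4 (r - 2) / 2 = r`. -/
theorem lintegral_rpow_two_four_le {r : ℝ} (hr : 2 < r) (hr' : r < 4) {f : α → ENNReal}
    (hf : AEMeasurable f ν) :
    ∫⁻ x, f x ^ r ∂ν ≤
      (∫⁻ x, f x ^ 2 ∂ν) ^ ((4 - r) / 2) * (∫⁻ x, f x ^ 4 ∂ν) ^ ((r - 2) / 2) := by
  refine le_trans (le_of_eq ?_) (ENNReal.lintegral_mul_norm_pow_le (hf.pow_const 2)
    (hf.pow_const 4) (by linarith) (by linarith) (by ring))
  refine lintegral_congr fun x => ?_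
  rw [← ENNReal.rpow_natCast_mul, ← ENNReal.rpow_natCast_mul,
    ← ENNReal.rpow_add_of_nonneg _ _ (by push_cast; linarith) (by push_cast; linarith)]
  congr 1
  push_cast
  ring

theorem norm_toLp_rpow {s : ℝ} (hs : 0 < s) {f : α → ℂ} (hf : MemLp f (ENNReal.ofReal s) ν) :
    ‖hf.toLp f‖ ^ s = ∫ x, ‖f x‖ ^ s ∂ν := by
  have h0 : 0 ≤ ∫ x, ‖f x‖ ^ s ∂ν := integral_nonneg fun x => by positivity
  rw [Lp.norm_toLp, hf.eLpNorm_eq_integral_rpow_norm (by simpa using hs) (by simp),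
    ENNReal.toReal_ofReal hs.le, ENNReal.toReal_ofReal (by positivity),
    ← Real.rpow_mul h0, inv_mul_cancel₀ hs.ne', Real.rpow_one]

theorem eLpNorm_ofReal_eq {s : ℝ} (hs : 0 < s) (f : α → ℂ) :
    eLpNorm f (ENNReal.ofReal s) ν = (∫⁻ x, ‖f x‖ₑ ^ s ∂ν) ^ (1 / s) := by
  rw [eLpNorm_eq_lintegral_rpow_enorm_toReal (by simpa using hs) (by simp),
    ENNReal.toReal_ofReal hs.le]

theorem tendsto_toLp_of_tendsto_lintegral {s : ℝ} (hs : 0 < s) [Fact (1 ≤ ENNReal.ofReal s)]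
    {f : ℕ → α → ℂ} {g : α → ℂ} (hf : ∀ n, MemLp (f n) (ENNReal.ofReal s) ν)
    (hg : MemLp g (ENNReal.ofReal s) ν)
    (h : Tendsto (fun n => ∫⁻ x, ‖f n x - g x‖ₑ ^ s ∂ν) atTop (𝓝 0)) :
    Tendsto (fun n => (hf n).toLp (f n)) atTop (𝓝 (hg.toLp g)) := by
  rw [Lp.tendsto_Lp_iff_tendsto_eLpNorm'' _ hf]
  have : Tendsto (fun n => (∫⁻ x, ‖f n x - g x‖ₑ ^ s ∂ν) ^ (1 / s)) atTop (𝓝 0) := by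
    have h1 := ((ENNReal.continuous_rpow_const (y := 1 / s)).tendsto 0).comp h
    rwa [ENNReal.zero_rpow_of_pos (by positivity)] at h1
  refine this.congr fun n => ?_
  rw [eLpNorm_ofReal_eq hs]
  rfl

theorem norm_sq_eq_integral (f : Lp ℂ 2 ν) : ‖f‖ ^ 2 = ∫ x, ‖f x‖ ^ 2 ∂ν := by
  have h0 : 0 ≤ ∫ x, ‖f x‖ ^ 2 ∂ν := integral_nonneg fun x => by positivity
  rw [Lp.norm_def, (Lp.memLp f).eLpNorm_eq_integral_rpow_norm (by simp) (by simp),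
    ENNReal.toReal_ofReal (by positivity)]
  simp only [ENNReal.toReal_ofNat, Real.rpow_ofNat]
  rw [← Real.rpow_natCast, ← Real.rpow_mul h0]
  simp

theorem lintegral_enorm_sq (f : Lp ℂ 2 ν) : ∫⁻ x, ‖f x‖ₑ ^ 2 ∂ν = ‖f‖ₑ ^ 2 := by
  rw [Lp.enorm_def, eLpNorm_eq_lintegral_rpow_enorm_toReal (by simp) (by simp)]
  simp only [ENNReal.toReal_ofNat, ENNReal.rpow_ofNat]
  rw [← ENNReal.rpow_mul_natCast]
  simp

end LpNorms

/-- Interpolate between `L²` and Ladyzhenskaya's `L⁴` bound. The `L²` norm from the latter is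
weakened to the `H¹` norm; the remaining power `4 - r` is positive. -/
theorem H1Plane.lintegral_rpow_le {r : ℝ} (hr : 2 < r) (hr' : r < 4) (φ : H1Plane) :
    ∫⁻ x, ‖H1.toFn φ x‖ₑ ^ r ≤
      ‖φ.1.fst‖ₑ ^ (4 - r) * (4 * (‖φ‖ₑ * ‖φ‖ₑ) ^ 2) ^ ((r - 2) / 2) := by
  refine (lintegral_rpow_two_four_le hr hr' (Lp.aestronglyMeasurable φ.1.fst).enorm).trans ?_
  refine mul_le_mul' (le_of_eq ?_) (ENNReal.rpow_le_rpow ?_ (by linarith))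
  · rw [lintegral_enorm_sq, ← ENNReal.rpow_natCast_mul]
    congr 1
    push_cast
    ring
  · refine (H1Plane.lintegral_pow_four_le φ).trans ?_
    grw [H1.enorm_fst_le φ]

/-- Write `|u|^p = |u|² |u|^(p-2)` and apply the sup bound to the second factor. -/
theorem H1Line.lintegral_rpow_le {p : ℝ} (hp : 2 < p) (u : H1Line) :
    ∫⁻ x, ‖H1.toFn u x‖ₑ ^ p ≤ ‖u.1.fst‖ₑ ^ (2 : ℝ) * (2 * (‖u‖ₑ * ‖u‖ₑ)) ^ ((p - 2) / 2) := by
  obtain ⟨g, hg, hug, hb⟩ := H1Line.exists_continuous_rep u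
  have hb' : ∀ x, ‖g x‖ₑ ^ 2 ≤ 2 * (‖u‖ₑ * ‖u‖ₑ) := fun x => by
    have h1 : ‖g x‖ ^ 2 ≤ 2 * (‖u‖ * ‖u‖) := (hb x).trans (by gcongr; exact H1.norm_fst_le u)
    have h2 := ENNReal.ofReal_le_ofReal h1
    rwa [ENNReal.ofReal_mul (by norm_num), ENNReal.ofReal_mul (by positivity),
      ENNReal.ofReal_pow (by positivity), ofReal_norm, ofReal_norm, ENNReal.ofReal_ofNat] at h2
  calc ∫⁻ x, ‖H1.toFn u x‖ₑ ^ p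
      ≤ ∫⁻ x, ‖H1.toFn u x‖ₑ ^ 2 * (2 * (‖u‖ₑ * ‖u‖ₑ)) ^ ((p - 2) / 2) := by
        refine lintegral_mono_ae ?_
        filter_upwards [hug] with x hx
        grw [hx, ← hb' x]
        rw [← ENNReal.rpow_natCast_mul, ← ENNReal.rpow_natCast,
          ← ENNReal.rpow_add_of_nonneg _ _ (by norm_num) (by push_cast; linarith)]
        · refine le_of_eq ?_
          congr 1
          push_cast
          ring
        · linarith
    _ = _ := by
        have hm : AEMeasurable (fun x => ‖H1.toFn u x‖ₑ ^ 2) volume :=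
          (Lp.aestronglyMeasurable u.1.fst).enorm.pow_const 2
        rw [lintegral_mul_const'' _ hm]
        congr 1
        rw [ENNReal.rpow_ofNat]
        exact lintegral_enorm_sq u.1.fst

theorem H1.memLp_of_lintegral {ι E : Type*} [Fintype ι] [NormedAddCommGroup E]
    [InnerProductSpace ℝ E] [FiniteDimensional ℝ E] [MeasurableSpace E] [BorelSpace E]
    {b : OrthonormalBasis ι ℝ E} {s : ℝ} (hs : 0 < s) (u : H1 b)
    (h : ∫⁻ x, ‖H1.toFn u x‖ₑ ^ s < ⊤) : MemLp (H1.toFn u) (ENNReal.ofReal s) := by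
  refine ⟨Lp.aestronglyMeasurable u.1.fst, ?_⟩
  rw [eLpNorm_ofReal_eq hs]
  exact ENNReal.rpow_lt_top_of_nonneg (by positivity) h.ne

theorem H1Plane.memLp {r : ℝ} (hr : 2 < r) (hr' : r < 4) (φ : H1Plane) :
    MemLp (H1.toFn φ) (ENNReal.ofReal r) := by
  refine H1.memLp_of_lintegral (by linarith) φ
    ((H1Plane.lintegral_rpow_le hr hr' φ).trans_lt ?_)
  exact ENNReal.mul_lt_top (ENNReal.rpow_lt_top_of_nonneg (by linarith) (by finiteness))
    (ENNReal.rpow_lt_top_of_nonneg (by linarith) (by finiteness))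

theorem H1Line.memLp {p : ℝ} (hp : 2 < p) (u : H1Line) :
    MemLp (H1.toFn u) (ENNReal.ofReal p) := by
  refine H1.memLp_of_lintegral (by linarith) u ((H1Line.lintegral_rpow_le hp u).trans_lt ?_)
  exact ENNReal.mul_lt_top (ENNReal.rpow_lt_top_of_nonneg (by linarith) (by finiteness))
    (ENNReal.rpow_lt_top_of_nonneg (by linarith) (by finiteness))

/-- On bounded sets of `H¹`, `L²` convergence implies `Lˢ` convergence, given an interpolation
inequality. -/
theorem H1.tendsto_toLp_of_interpolation {ι E : Type*} [Fintype ι] [NormedAddCommGroup E]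
    [InnerProductSpace ℝ E] [FiniteDimensional ℝ E] [MeasurableSpace E] [BorelSpace E]
    {b : OrthonormalBasis ι ℝ E} {s a : ℝ} (hs : 0 < s) [Fact (1 ≤ ENNReal.ofReal s)]
    (ha : 0 < a) {B : ENNReal → ENNReal} (hB : Monotone B) (hB' : ∀ c, c ≠ ⊤ → B c ≠ ⊤)
    (hi : ∀ u : H1 b, ∫⁻ x, ‖H1.toFn u x‖ₑ ^ s ≤ ‖u.1.fst‖ₑ ^ a * B ‖u‖ₑ)
    {u : ℕ → H1 b} {w : H1 b} {C : ℝ} (hC : ∀ n, ‖u n - w‖ ≤ C)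
    (hlim : Tendsto (fun n => (u n - w).1.fst) atTop (𝓝 0))
    (hu : ∀ n, MemLp (H1.toFn (u n)) (ENNReal.ofReal s))
    (hw : MemLp (H1.toFn w) (ENNReal.ofReal s)) :
    Tendsto (fun n => (hu n).toLp _) atTop (𝓝 (hw.toLp _)) := by
  refine tendsto_toLp_of_tendsto_lintegral hs hu hw ?_
  have h1 : Tendsto (fun n => ‖(u n - w).1.fst‖ₑ ^ a * B (ENNReal.ofReal C)) atTop (𝓝 0) := by
    have h2 := ((ENNReal.continuous_rpow_const (y := a)).tendsto 0).comp
      (by simpa using hlim.enorm)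
    rw [ENNReal.zero_rpow_of_pos ha] at h2
    simpa using ENNReal.Tendsto.mul_const h2 (Or.inr (hB' (ENNReal.ofReal C) (by finiteness)))
  refine tendsto_of_tendsto_of_tendsto_of_le_of_le tendsto_const_nhds h1 (fun n => bot_le)
    fun n => ?_
  calc ∫⁻ x, ‖H1.toFn (u n) x - H1.toFn w x‖ₑ ^ s = ∫⁻ x, ‖H1.toFn (u n - w) x‖ₑ ^ s := by
        refine lintegral_congr_ae ?_
        filter_upwards [H1.toFn_sub_ae (u n) w] with x hx
        rw [hx]
    _ ≤ _ := hi _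
    _ ≤ _ := by
        gcongr
        apply hB
        rw [← ofReal_norm]
        exact ENNReal.ofReal_le_ofReal (hC n)

/-! ### Integrability of the Macdonald kernel -/

section Kernel

theorem measurable_besselK0 : Measurable besselK0 := by
  have h : StronglyMeasurable (Function.uncurry fun x t : ℝ => Real.exp (-x * Real.cosh t)) := by
    apply Continuous.stronglyMeasurable
    simp only [Function.uncurry_def]
    fun_prop
  exact (h.integral_prod_right (ν := volume.restrict (Set.Ioi (0 : ℝ)))).measurable

theorem besselK0_nonneg (x : ℝ) : 0 ≤ besselK0 x :=
  integral_nonneg fun _ => (Real.exp_pos _).le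

theorem one_add_sq_div_two_le_cosh {t : ℝ} (ht : 0 ≤ t) : 1 + t ^ 2 / 2 ≤ Real.cosh t := by
  have h1 := Real.cosh_two_mul (t / 2)
  have h2 := Real.cosh_sq' (t / 2)
  have h3 := Real.self_le_sinh_iff.2 (show 0 ≤ t / 2 by positivity)
  rw [mul_div_cancel₀ t (by norm_num : (2 : ℝ) ≠ 0)] at h1
  nlinarith

/-- The bound `cosh t ≥ 1 + t² / 2` leaves a Gaussian integral. The resulting singularity `x^(-1/2)`
is cruder than the true logarithm but suffices for exponents below `4`. -/
theorem besselK0_le {x : ℝ} (hx : 0 < x) :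
    besselK0 x ≤ Real.exp (-x) * (Real.sqrt (Real.pi / (x / 2)) / 2) := by
  rw [← integral_gaussian_Ioi, ← integral_const_mul, besselK0]
  refine integral_mono_of_nonneg (Eventually.of_forall fun t => (Real.exp_pos _).le)
    ((integrable_exp_neg_mul_sq (by positivity)).integrableOn.const_mul _) ?_
  filter_upwards [ae_restrict_mem measurableSet_Ioi] with t ht
  rw [← Real.exp_add]
  apply Real.exp_le_exp.2
  have := mul_le_mul_of_nonneg_left (one_add_sq_div_two_le_cosh (le_of_lt ht)) hx.le
  linarith

/-- The singular part `K₀(|x|) / (2π)` of a state of charge one. -/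
def kernelFn (x : Plane) : ℂ := (besselK0 ‖x‖ / (2 * Real.pi) : ℝ)

/-- In polar coordinates the integrand is at most `e^(-y) y^(1 - s/2)`, the integrand of `Γ(2 -
s/2)`, and `2 - s/2 > 0` because `s < 4`. -/
theorem memLp_kernelFn {s : ℝ} (hs : 2 ≤ s) (hs' : s < 4) :
    MemLp kernelFn (ENNReal.ofReal s) volume := by
  have hm : AEStronglyMeasurable kernelFn volume := by
    refine Measurable.aestronglyMeasurable ?_
    exact Complex.measurable_ofReal.comp ((measurable_besselK0.comp measurable_norm).div_const _)
  rw [← integrable_norm_rpow_iff hm (by simp; linarith) (by simp),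
    ENNReal.toReal_ofReal (by linarith)]
  have heq : (fun x => ‖kernelFn x‖ ^ s) =
      fun x : Plane => (fun y : ℝ => (besselK0 y / (2 * Real.pi)) ^ s) ‖x‖ := by
    funext x
    have := besselK0_nonneg ‖x‖
    simp only [kernelFn, Complex.norm_real, Real.norm_eq_abs]
    rw [abs_of_nonneg (by positivity)]
  rw [heq, integrable_fun_norm_addHaar volume (f := fun y : ℝ => (besselK0 y / (2 * Real.pi)) ^ s)]
  simp only [finrank_euclideanSpace, Fintype.card_fin, Nat.add_one_sub_one, pow_one, smul_eq_mul]
  have hG := Real.GammaIntegral_convergent (s := 2 - s / 2) (by linarith)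
  refine Integrable.mono' hG ?_ ?_
  · exact (measurable_id.mul ((measurable_besselK0.div_const _).pow_const s)).aestronglyMeasurable
  · filter_upwards [ae_restrict_mem measurableSet_Ioi] with y hy
    have hy : 0 < y := hy
    have h0 := besselK0_nonneg y
    have hle : besselK0 y / (2 * Real.pi) ≤ Real.exp (-y) * y ^ (-(1 / 2) : ℝ) := by
      rw [div_le_iff₀ (by positivity)]
      refine (besselK0_le hy).trans ?_
      rw [mul_assoc]
      gcongr
      have hsq : Real.sqrt (Real.pi / (y / 2)) = Real.sqrt (2 * Real.pi) * y ^ (-(1 / 2) : ℝ) := by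
        rw [Real.rpow_neg hy.le, ← Real.sqrt_eq_rpow, ← Real.sqrt_inv,
          ← Real.sqrt_mul (by positivity)]
        congr 1
        field_simp
      rw [hsq]
      have h1 : Real.sqrt (2 * Real.pi) ≤ 2 * Real.pi := by
        rw [Real.sqrt_le_left (by positivity)]
        nlinarith [Real.pi_gt_three]
      have h2 : 0 < y ^ (-(1 / 2) : ℝ) := by positivity
      nlinarith [Real.pi_gt_three]
    rw [Real.norm_of_nonneg (by positivity)]
    calc y * (besselK0 y / (2 * Real.pi)) ^ s
        ≤ y * (Real.exp (-y) * y ^ (-(1 / 2) : ℝ)) ^ s := by gcongr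
      _ = Real.exp (-y * s) * y ^ (2 - s / 2 - 1) := by
          rw [Real.mul_rpow (by positivity) (by positivity), ← Real.exp_mul, ← Real.rpow_mul hy.le]
          have : (2 - s / 2 - 1 : ℝ) = 1 + -(1 / 2) * s := by ring
          rw [this, Real.rpow_add hy, Real.rpow_one]
          ring
      _ ≤ Real.exp (-y) * y ^ (2 - s / 2 - 1) := by
          gcongr
          nlinarith

end Kernel

/-! ### Weak convergence: boundedness and lower semicontinuity -/

section WeakConvergence

variable {H : Type*} [NormedAddCommGroup H]

theorem WeakTendsto.tendsto_apply [NormedSpace ℂ H] {x : ℕ → H} {y : H} (h : WeakTendsto x y)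
    (L : H →L[ℂ] ℂ) : Tendsto (fun n => L (x n)) atTop (𝓝 (L y)) :=
  ((WeakBilin.eval_continuous (topDualPairing ℂ H).flip L).tendsto _).comp h

/-- Uniform boundedness for the `x n` viewed isometrically in the bidual: each functional is bounded
along the sequence. -/
theorem WeakTendsto.exists_norm_le [NormedSpace ℂ H] {x : ℕ → H} {y : H} (h : WeakTendsto x y) :
    ∃ C, ∀ n, ‖x n‖ ≤ C := by
  obtain ⟨C, hC⟩ := banach_steinhaus
    (g := fun n => NormedSpace.inclusionInDoubleDualLi (E := H) ℂ (x n)) fun L => by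
      obtain ⟨C, hC⟩ := (h.tendsto_apply L).norm.bddAbove_range
      exact ⟨C, fun n => hC ⟨n, rfl⟩⟩
  exact ⟨C, fun n => ((NormedSpace.inclusionInDoubleDualLi ℂ).norm_map (x n)).symm.trans_le (hC n)⟩

/-- Expand `0 ≤ ‖y - x‖²`. This real-affine minorant of `‖x‖²` is exact at `x = y` and passes to
weak limits, so it encodes lower semicontinuity without a `liminf`. -/
theorem two_mul_re_inner_sub_le_norm_sq [InnerProductSpace ℂ H] (x y : H) :
    2 * (inner ℂ y x).re - ‖y‖ ^ 2 ≤ ‖x‖ ^ 2 := by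
  have h := norm_sub_sq (𝕜 := ℂ) y x
  have h0 := sq_nonneg ‖y - x‖
  simp only [RCLike.re_eq_complex_re] at h
  linarith

theorem tendsto_two_mul_re_inner_sub [InnerProductSpace ℂ H] {x : ℕ → H} {y : H}
    (h : Tendsto (fun n => inner ℂ y (x n)) atTop (𝓝 (inner ℂ y y))) :
    Tendsto (fun n => 2 * (inner ℂ y (x n)).re - ‖y‖ ^ 2) atTop (𝓝 (‖y‖ ^ 2)) := by
  have h1 := (((Complex.continuous_re.tendsto _).comp h).const_mul 2).sub_const (‖y‖ ^ 2)
  have h2 : 2 * (inner ℂ y y).re - ‖y‖ ^ 2 = ‖y‖ ^ 2 := by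
    rw [← RCLike.re_eq_complex_re, inner_self_eq_norm_sq]
    ring
  rw [h2] at h1
  exact h1

end WeakConvergence

/-- The component on the plane of a state, as an element of `L²`. -/
def EnergyDomain.planeL2 (U : EnergyDomain) : Lp ℂ 2 (volume : Measure Plane) :=
  U.φ.1.fst + U.q • (show MemLp kernelFn 2 volume by
    simpa using memLp_kernelFn (s := 2) le_rfl (by norm_num)).toLp kernelFn

theorem EnergyDomain.planeL2_ae (U : EnergyDomain) : U.planeL2 =ᵐ[volume] U.v := by
  have hK : MemLp kernelFn 2 volume := by
    simpa using memLp_kernelFn (s := 2) le_rfl (by norm_num)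
  filter_upwards [Lp.coeFn_add U.φ.1.fst (U.q • hK.toLp kernelFn),
    Lp.coeFn_smul U.q (hK.toLp kernelFn), hK.coeFn_toLp] with x h1 h2 h3
  rw [EnergyDomain.planeL2, h1, Pi.add_apply, h2, Pi.smul_apply, h3]
  rfl

theorem EnergyDomain.norm_planeL2_sq (U : EnergyDomain) :
    ‖U.planeL2‖ ^ 2 = ∫ x, ‖U.v x‖ ^ 2 := by
  rw [norm_sq_eq_integral]
  refine integral_congr_ae ?_
  filter_upwards [U.planeL2_ae] with x hx
  rw [hx]

theorem EnergyDomain.mass_eq (U : EnergyDomain) :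
    U.mass = ‖U.u.1.fst‖ ^ 2 + ‖U.planeL2‖ ^ 2 := by
  rw [EnergyDomain.mass, U.norm_planeL2_sq, norm_sq_eq_integral]
  rfl

theorem EnergyDomain.integral_norm_v_rpow {r : ℝ} (hr : 2 < r) (hr' : r < 4)
    (U : EnergyDomain) : ∫ x, ‖U.v x‖ ^ r =
      ‖(H1Plane.memLp hr hr' U.φ).toLp _ + U.q • (memLp_kernelFn hr.le hr').toLp kernelFn‖ ^ r := by
  rw [← MemLp.toLp_const_smul, ← MemLp.toLp_add, norm_toLp_rpow (by linarith)]
  rfl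

/-! ### Strong convergence from conservation of mass, and the energy -/

section Compactness

variable {V : ℕ → EnergyDomain} {U : EnergyDomain}

/-- The continuous projection of `H¹` to `L²`. -/
def H1.fstCLM {ι E : Type*} [Fintype ι] [NormedAddCommGroup E]
    [InnerProductSpace ℝ E] [FiniteDimensional ℝ E] [MeasurableSpace E] [BorelSpace E]
    (b : OrthonormalBasis ι ℝ E) : H1 b →L[ℂ] Lp ℂ 2 (volume : Measure E) :=
  (WithLp.fstL 2 ℂ _ _).comp (H1 b).subtypeL

/-- The weak gradient as a continuous linear map. -/
def H1.sndCLM {ι E : Type*} [Fintype ι] [NormedAddCommGroup E]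
    [InnerProductSpace ℝ E] [FiniteDimensional ℝ E] [MeasurableSpace E] [BorelSpace E]
    (b : OrthonormalBasis ι ℝ E) :
    H1 b →L[ℂ] PiLp 2 (fun _ : ι => Lp ℂ 2 (volume : Measure E)) :=
  (WithLp.sndL 2 ℂ _ _).comp (H1 b).subtypeL

theorem tendsto_inner_planeL2 (hφ : WeakTendsto (fun n => (V n).φ) U.φ)
    (hq : Tendsto (fun n => (V n).q) atTop (𝓝 U.q)) (z : Lp ℂ 2 (volume : Measure Plane)) :
    Tendsto (fun n => inner ℂ z (V n).planeL2) atTop (𝓝 (inner ℂ z U.planeL2)) := by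
  simp only [EnergyDomain.planeL2, inner_add_right, inner_smul_right]
  exact (hφ.tendsto_apply ((innerSL ℂ z).comp (H1.fstCLM _))).add (hq.mul_const _)

/-- Expanding both squared distances, their sum is `2 U.mass` minus twice the real parts of inner
products that tend to `U.mass` in total. Only the total mass is fixed, so the components are treated
together and separated by nonnegativity. -/
theorem tendsto_L2_of_mass (hu : WeakTendsto (fun n => (V n).u) U.u)
    (hφ : WeakTendsto (fun n => (V n).φ) U.φ) (hq : Tendsto (fun n => (V n).q) atTop (𝓝 U.q))
    (hm : ∀ n, (V n).mass = U.mass) :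
    Tendsto (fun n => (V n).u.1.fst - U.u.1.fst) atTop (𝓝 0) ∧
      Tendsto (fun n => (V n).planeL2 - U.planeL2) atTop (𝓝 0) := by
  have h1 := hu.tendsto_apply ((innerSL ℂ U.u.1.fst).comp (H1.fstCLM _))
  have h2 := tendsto_inner_planeL2 hφ hq U.planeL2
  have hre : ∀ {H : Type} [NormedAddCommGroup H] [InnerProductSpace ℂ H] (x : H),
      (inner ℂ x x).re = ‖x‖ ^ 2 := fun x => by
    rw [← RCLike.re_eq_complex_re, inner_self_eq_norm_sq]
  have h3 : Tendsto (fun n => ‖(V n).u.1.fst - U.u.1.fst‖ ^ 2 + ‖(V n).planeL2 - U.planeL2‖ ^ 2)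
      atTop (𝓝 0) := by
    have h4 := ((Complex.continuous_re.tendsto _).comp h1).add
      ((Complex.continuous_re.tendsto _).comp h2)
    have h5 := (h4.const_mul 2).const_sub (2 * U.mass)
    have h6 : 2 * U.mass - 2 * ((((innerSL ℂ U.u.1.fst).comp (H1.fstCLM _)) U.u).re +
        (inner ℂ U.planeL2 U.planeL2).re) = 0 := by
      change 2 * U.mass - 2 * ((inner ℂ U.u.1.fst U.u.1.fst).re +
        (inner ℂ U.planeL2 U.planeL2).re) = 0
      rw [hre, hre, U.mass_eq]
      ring
    rw [h6] at h5
    refine h5.congr fun n => ?_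
    change 2 * U.mass - 2 * ((inner ℂ U.u.1.fst (V n).u.1.fst).re +
        (inner ℂ U.planeL2 (V n).planeL2).re) = _
    have e1 := norm_sub_sq (𝕜 := ℂ) U.u.1.fst (V n).u.1.fst
    have e2 := norm_sub_sq (𝕜 := ℂ) U.planeL2 (V n).planeL2
    simp only [RCLike.re_eq_complex_re] at e1 e2
    have e3 := hm n
    rw [(V n).mass_eq] at e3
    have e4 := U.mass_eq
    rw [norm_sub_rev (V n).u.1.fst, norm_sub_rev (V n).planeL2]
    linarith
  constructor
  · rw [tendsto_zero_iff_norm_tendsto_zero]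
    have := squeeze_zero (fun n => by positivity)
      (fun n => le_add_of_nonneg_right (by positivity)) h3
    simpa using this.sqrt
  · rw [tendsto_zero_iff_norm_tendsto_zero]
    have := squeeze_zero (fun n => by positivity)
      (fun n => le_add_of_nonneg_left (by positivity)) h3
    simpa using this.sqrt

theorem tendsto_valueAtZero {u : ℕ → H1Line} {w : H1Line} {C : ℝ} (hC : ∀ n, ‖u n - w‖ ≤ C)
    (hlim : Tendsto (fun n => (u n - w).1.fst) atTop (𝓝 0)) :
    Tendsto (fun n => valueAtZero (u n)) atTop (𝓝 (valueAtZero w)) := by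
  rw [tendsto_iff_norm_sub_tendsto_zero]
  have h1 : Tendsto (fun n => 2 * (‖(u n - w).1.fst‖ * C)) atTop (𝓝 0) := by
    simpa using (hlim.norm.mul_const C).const_mul 2
  have h2 : Tendsto (fun n => ‖valueAtZero (u n) - valueAtZero w‖ ^ 2) atTop (𝓝 0) := by
    refine squeeze_zero (fun n => by positivity) (fun n => ?_) h1
    rw [← valueAtZero_sub]
    refine (norm_valueAtZero_sq_le _).trans ?_
    gcongr
    exact hC n
  simpa using h2.sqrt

theorem tendsto_integral_line {p : ℝ} (hp : 2 < p) {u : ℕ → H1Line} {w : H1Line} {C : ℝ}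
    (hC : ∀ n, ‖u n - w‖ ≤ C) (hlim : Tendsto (fun n => (u n - w).1.fst) atTop (𝓝 0)) :
    Tendsto (fun n => ∫ x, ‖H1.toFn (u n) x‖ ^ p) atTop (𝓝 (∫ x, ‖H1.toFn w x‖ ^ p)) := by
  have : Fact (1 ≤ ENNReal.ofReal p) := ⟨by simp; linarith⟩
  have h := H1.tendsto_toLp_of_interpolation (s := p) (by linarith) (a := 2) (by norm_num)
    (B := fun c => (2 * (c * c)) ^ ((p - 2) / 2))
    (fun c d hcd => ENNReal.rpow_le_rpow (by gcongr) (by linarith))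
    (fun c hc => (ENNReal.rpow_lt_top_of_nonneg (by linarith) (by finiteness)).ne)
    (fun u => H1Line.lintegral_rpow_le hp u) hC hlim (fun n => H1Line.memLp hp (u n))
    (H1Line.memLp hp w)
  simp_rw [← fun u => norm_toLp_rpow (by linarith : 0 < p) (H1Line.memLp hp u)]
  exact h.norm.rpow_const (Or.inr (by linarith))

theorem tendsto_integral_plane {r : ℝ} (hr : 2 < r) (hr' : r < 4) {C : ℝ}
    (hC : ∀ n, ‖(V n).φ - U.φ‖ ≤ C)
    (hlim : Tendsto (fun n => ((V n).φ - U.φ).1.fst) atTop (𝓝 0))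
    (hq : Tendsto (fun n => (V n).q) atTop (𝓝 U.q)) :
    Tendsto (fun n => ∫ x, ‖(V n).v x‖ ^ r) atTop (𝓝 (∫ x, ‖U.v x‖ ^ r)) := by
  have : Fact (1 ≤ ENNReal.ofReal r) := ⟨by simp; linarith⟩
  have h := H1.tendsto_toLp_of_interpolation (s := r) (by linarith) (a := 4 - r) (by linarith)
    (B := fun c => (4 * (c * c) ^ 2) ^ ((r - 2) / 2))
    (fun c d hcd => ENNReal.rpow_le_rpow (by gcongr) (by linarith))
    (fun c hc => (ENNReal.rpow_lt_top_of_nonneg (by linarith) (by finiteness)).ne)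
    (fun u => H1Plane.lintegral_rpow_le hr hr' u) hC hlim
    (fun n => H1Plane.memLp hr hr' (V n).φ) (H1Plane.memLp hr hr' U.φ)
  simp_rw [EnergyDomain.integral_norm_v_rpow hr hr']
  exact (h.add (hq.smul_const _)).norm.rpow_const (Or.inr (by linarith))

/-- The energy is lower semicontinuous along weakly convergent sequences without loss of mass. -/
theorem exists_tendsto_energy_le {α σ β p r : ℝ} (hp : 2 < p) (hr : 2 < r) (hr' : r < 4)
    (hu : WeakTendsto (fun n => (V n).u) U.u) (hφ : WeakTendsto (fun n => (V n).φ) U.φ)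
    (hq : Tendsto (fun n => (V n).q) atTop (𝓝 U.q)) (hm : ∀ n, (V n).mass = U.mass) :
    ∃ e : ℕ → ℝ, (∀ n, e n ≤ (V n).energy α σ β p r) ∧
      Tendsto e atTop (𝓝 (U.energy α σ β p r)) := by
  obtain ⟨hu2, hv2⟩ := tendsto_L2_of_mass hu hφ hq hm
  have hφ2 : Tendsto (fun n => ((V n).φ - U.φ).1.fst) atTop (𝓝 0) := by
    -- Use `φ_n - φ = (v_n - v) - (q_n - q) K₀ / (2π)`.
    have h1 := hv2.sub ((hq.sub_const U.q).smul_const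
      ((show MemLp kernelFn 2 volume by
        simpa using memLp_kernelFn (s := 2) le_rfl (by norm_num)).toLp kernelFn))
    simp only [sub_self, zero_smul] at h1
    refine h1.congr fun n => ?_
    change _ = (V n).φ.1.fst - U.φ.1.fst
    simp only [EnergyDomain.planeL2, sub_smul]
    abel
  obtain ⟨C₁, hC₁⟩ := hu.exists_norm_le
  obtain ⟨C₂, hC₂⟩ := hφ.exists_norm_le
  have hb₁ : ∀ n, ‖(V n).u - U.u‖ ≤ C₁ + ‖U.u‖ := fun n =>
    (norm_sub_le _ _).trans (by gcongr; exact hC₁ n)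
  have hb₂ : ∀ n, ‖(V n).φ - U.φ‖ ≤ C₂ + ‖U.φ‖ := fun n =>
    (norm_sub_le _ _).trans (by gcongr; exact hC₂ n)
  have t0 := tendsto_valueAtZero hb₁ hu2
  have tp := tendsto_integral_line hp hb₁ hu2
  have tr := tendsto_integral_plane hr hr' hb₂ hφ2 hq
  have t2 : Tendsto (fun n => ∫ x, ‖(V n).v x‖ ^ 2) atTop (𝓝 (∫ x, ‖U.v x‖ ^ 2)) := by
    simp_rw [← EnergyDomain.norm_planeL2_sq]
    exact ((tendsto_sub_nhds_zero_iff.1 hv2).norm).pow 2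
  have tg : Tendsto (fun n => 2 * (inner ℂ U.u.1.snd (V n).u.1.snd).re - ‖U.u.1.snd‖ ^ 2) atTop
      (𝓝 (H1.gradNorm U.u ^ 2)) :=
    tendsto_two_mul_re_inner_sub
      (hu.tendsto_apply ((innerSL ℂ U.u.1.snd).comp (H1.sndCLM _)))
  have tφ : Tendsto (fun n => 2 * (inner ℂ U.φ (V n).φ).re - ‖U.φ‖ ^ 2) atTop
      (𝓝 (‖U.φ‖ ^ 2)) :=
    tendsto_two_mul_re_inner_sub (hφ.tendsto_apply (innerSL ℂ U.φ))
  have tc : Tendsto (fun n => (conj (V n).q * valueAtZero (V n).u).re) atTop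
      (𝓝 (conj U.q * valueAtZero U.u).re) :=
    (Complex.continuous_re.tendsto _).comp (((Complex.continuous_conj.tendsto _).comp hq).mul t0)
  -- The energy of `V n` with `‖u_n'‖²` and `‖φ_n‖²` replaced by their affine minorants at `U`;
  -- every other term is kept and converges.
  refine ⟨fun n => ((1 / 2 * (2 * (inner ℂ U.u.1.snd (V n).u.1.snd).re - ‖U.u.1.snd‖ ^ 2)
      - 1 / p * (∫ x, ‖H1.toFn (V n).u x‖ ^ p)) + α / 2 * ‖valueAtZero (V n).u‖ ^ 2) +
      (1 / 2 * (2 * (inner ℂ U.φ (V n).φ).re - ‖U.φ‖ ^ 2) - 1 / 2 * (∫ x, ‖(V n).v x‖ ^ 2)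
        + σ / 2 * ‖(V n).q‖ ^ 2 - 1 / r * (∫ x, ‖(V n).v x‖ ^ r)) -
      β * (conj (V n).q * valueAtZero (V n).u).re, fun n => ?_, ?_⟩
  · have h1 : _ ≤ H1.gradNorm (V n).u ^ 2 :=
      two_mul_re_inner_sub_le_norm_sq (V n).u.1.snd U.u.1.snd
    have h2 := two_mul_re_inner_sub_le_norm_sq (V n).φ U.φ
    simp only [EnergyDomain.energy, EnergyDomain.energyLine, EnergyDomain.energyPlane]
    linarith
  · exact (((tg.const_mul _).sub (tp.const_mul _)).add ((t0.norm.pow 2).const_mul _)).add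
      ((((tφ.const_mul _).sub (t2.const_mul _)).add ((hq.norm.pow 2).const_mul _)).sub
        (tr.const_mul _)) |>.sub (tc.const_mul β)

end Compactness

end Hybrid

end

theorem proposition3p6 (α σ β p r μ : ℝ) (hβ : 0 ≤ β) (hp : 2 < p) (hp' : p < 6)
    (hr : 2 < r) (hr' : r < 4) (hμ : 0 < μ)
    (Us : ℕ → Hybrid.EnergyDomain) (U : Hybrid.EnergyDomain)
    (hUs : Hybrid.IsMinimizingSeq α σ β p r μ Us) (hU : Hybrid.IsWeakLimit Us U)
    (hmass : U.mass = μ) :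
    Hybrid.IsGroundState α σ β p r μ U := by
  obtain ⟨k, hk, hu, hφ, hq⟩ := hU
  obtain ⟨e, he, hlim⟩ := Hybrid.exists_tendsto_energy_le (α := α) (σ := σ) (β := β) hp hr hr'
    hu hφ hq (fun n => (hUs.1 (k n)).trans hmass.symm)
  -- The comparison is made in `EReal` because the infimum is not known to be finite beforehand.
  have hinf : ((U.energy α σ β p r : ℝ) : EReal) ≤ Hybrid.infEnergy α σ β p r μ :=
    le_of_tendsto_of_tendsto' ((continuous_coe_real_ereal.tendsto _).comp hlim)
      (hUs.2.comp hk.tendsto_atTop) fun n => EReal.coe_le_coe_iff.2 (he n)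
  exact ⟨hmass, fun W hW => EReal.coe_le_coe_iff.1 (hinf.trans (iInf₂_le W hW))⟩
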